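/- Let $n,\ell\ge 0$ be integers, and let $\mathcal H_1,\dots,\mathcal H_n$ be finite-dimensional complex inner product spaces, $\mathcal H_j=\mathbb C^{d_j}$, with a distinguished unit vector $|q_1\rangle\in\mathcal H_j$ for each $j$ (for instance $n$ copies of one space with one unit vector $|q_1\rangle$). For $J\subseteq[n]=\{1,\dots,n\}$ write $\mathcal H_J=\bigotimes_{j\in J}\mathcal H_j$, and let $|q_1\rangle\langle q_1|^{\otimes J}$ be the operator on $\mathcal H_J$ whose factor at each $j\in J$ is the projector onto the distinguished vector of $\mathcal H_j$. Let $I_1,\dots,I_\ell\subseteq[n]$, with complements $I_i^c=[n]\setminus I_i$. For each $i\in[\ell]$ let $Q_{I_i^c}=\bigotimes_{j\in I_i^c}Q_{I_i^c,j}$, where each $Q_{I_i^c,j}$ is an operator on $\mathcal H_j$ whose largest singular value is $\alpha_{i,j}>0$ and which is of the form $$Q_{I_i^c,j}=\alpha_{i,j}\,|q_1\rangle\langle q_1|\oplus W_{i,j}$$ with respect to the orthogonal decomposition $\mathcal H_j=\mathbb C|q_1\rangle\oplus|q_1\rangle^{\perp}$, for some operator $W_{i,j}$ on $|q_1\rangle^{\perp}$.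 Let $|||\cdot|||$ be any unitarily invariant norm on the operators on $\mathcal H_{[n]}$, that is, a norm with $|||UAV|||=|||A|||$ for all operators $A$ and all unitaries $U,V$. Let $\|R\|_1=\operatorname{tr}\sqrt{R^*R}$ denote the trace norm. Then the maximization problem $$\max_{(R_{I_i})_{i=1}^{\ell}}\ \Big|\Big|\Big|\prod_{i=1}^{\ell}R_{I_i}\otimes Q_{I_i^c}\Big|\Big|\Big|$$ over all tuples of operators $R_{I_i}$ on $\mathcal H_{I_i}$ with $\|R_{I_i}\|_1\le1$ for every $i$ has $\big(|q_1\rangle\langle q_1|^{\otimes I_i}\big)_{i=1}^{\ell}$ as a solution: this tuple satisfies the constraints, and for every tuple satisfying them $$\Big|\Big|\Big|\prod_{i=1}^{\ell}R_{I_i}\otimes Q_{I_i^c}\Big|\Big|\Big|\ \le\ \Big|\Big|\Big|\prod_{i=1}^{\ell}|q_1\rangle\langle q_1|^{\otimes I_i}\otimes Q_{I_i^c}\Big|\Big|\Big|.$$ Here the product is the operator product in the order $i=1,\dots,\ell$, and $R_{I_i}\otimes Q_{I_i^c}$ acts with $R_{I_i}$ on the factors in $I_i$ and with $Q_{I_i^c}$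 on the factors in $I_i^c$. -/

import Mathlib

open scoped MatrixOrder

/-- Index set of the standard product basis of `⨂_{j ∈ J} ℂ^{d j}`. -/
abbrev RegionIndex {n : ℕ} (d : Fin n → ℕ) (J : Finset (Fin n)) : Type :=
  (j : ↥J) → Fin (d j)

/-- Operators on `⨂_{j ∈ J} ℂ^{d j}`, as matrices in the standard product basis. -/
abbrev RegionOp {n : ℕ} (d : Fin n → ℕ) (J : Finset (Fin n)) : Type :=
  Matrix (RegionIndex d J) (RegionIndex d J) ℂ

/-- Operators on the whole space `⨂_{j ∈ [n]} ℂ^{d j}`, as matrices in the standard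
product basis. -/
abbrev GlobalOp {n : ℕ} (d : Fin n → ℕ) : Type :=
  Matrix ((j : Fin n) → Fin (d j)) ((j : Fin n) → Fin (d j)) ℂ

/-- The product operator `⨂_{j ∈ J} A j`. -/
def productOp {n : ℕ} {d : Fin n → ℕ} {J : Finset (Fin n)}
    (A : (j : ↥J) → Matrix (Fin (d j)) (Fin (d j)) ℂ) : RegionOp d J :=
  Matrix.of fun x y => ∏ j : ↥J, A j (x j) (y j)

/-- The operator `R ⊗ S` on the whole space, where `R` acts on the tensor factors in `I`
and `S` on the tensor factors in the complement of `I`. -/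
def regionTensor {n : ℕ} {d : Fin n → ℕ} (I : Finset (Fin n))
    (R : RegionOp d I) (S : RegionOp d Iᶜ) : GlobalOp d :=
  Matrix.of fun x y => R (I.restrict x) (I.restrict y) * S (Iᶜ.restrict x) (Iᶜ.restrict y)

/-- The rank one operator `|q⟩⟨q|`. -/
def ketbra {m : ℕ} (q : EuclideanSpace ℂ (Fin m)) : Matrix (Fin m) (Fin m) ℂ :=
  Matrix.vecMulVec (fun a => q a) (fun a => star (q a))

/-- The trace norm `‖R‖₁ = tr |R|`, where `|R| = √(R* R)`. -/
noncomputable def traceNorm {ι : Type*} [Fintype ι] [DecidableEq ι] (R : Matrix ι ι ℂ) : ℝ :=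
  (CFC.abs R).trace.re

/-- The largest singular value of a square matrix. -/
noncomputable def largestSingularValue {m : ℕ} (A : Matrix (Fin m) (Fin m) ℂ) : ℝ :=
  (Matrix.toEuclideanLin A).singularValues 0

/-- `A` is of the form `α |q⟩⟨q| ⊕ W` with respect to the orthogonal decomposition
`ℂ q ⊕ q^⊥`. The block `W`, an operator on `q^⊥`, is extended by zero to the whole space:
it annihilates `q`, and its range is orthogonal to `q`. -/
def IsBlockForm {m : ℕ} (q : EuclideanSpace ℂ (Fin m)) (α : ℝ)
    (A : Matrix (Fin m) (Fin m) ℂ) : Prop :=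
  ∃ W : Matrix (Fin m) (Fin m) ℂ,
    Matrix.mulVec W (fun a => q a) = 0 ∧
    Matrix.vecMul (fun a => star (q a)) W = 0 ∧
    A = (α : ℂ) • ketbra q + W

/-- A unitarily invariant norm on the operators on `ℂ^ι`: a seminorm that is definite and
satisfies `N (U A V) = N A` for all unitaries `U` and `V`. -/
structure IsUnitarilyInvariantNorm {ι : Type*} [Fintype ι] [DecidableEq ι]
    (N : Seminorm ℂ (Matrix ι ι ℂ)) : Prop where
  definite : ∀ A, N A = 0 → A = 0
  invariant : ∀ U ∈ Matrix.unitaryGroup ι ℂ, ∀ V ∈ Matrix.unitaryGroup ι ℂ,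
    ∀ A, N (U * A * V) = N A

/-- The ordered product `∏_{i=1}^ℓ R_{I_i} ⊗ Q_{I_i^c}`, with `Q_{I_i^c} = ⨂_{j ∉ I_i} Q i j`;
the factor with the smallest index stands on the left. -/
def overlapProduct {n ℓ : ℕ} {d : Fin n → ℕ} (I : Fin ℓ → Finset (Fin n))
    (Q : (i : Fin ℓ) → (j : ↥(I i)ᶜ) → Matrix (Fin (d j)) (Fin (d j)) ℂ)
    (R : (i : Fin ℓ) → RegionOp d (I i)) : GlobalOp d :=
  (List.ofFn fun i => regionTensor (I i) (R i) (productOp (Q i))).prod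

/-!
Write an operator as a sum of rank one operators whose norms add up to its trace norm
(`exists_eq_sum_vecMulVec`). By the triangle inequality every `R i` may then be taken of rank one,
and a factor of the product becomes `|a⟩⟨b| ⊗ Q` (`localAtom`), where `Q` is a product operator
whose site factors have `q j` as a common left and right eigenvector, with eigenvalue equal to
the operator norm (`IsLocalFactor`).

The central computation concerns two such factors, over regions `J` and `I`. In
`(|a⟩⟨b| ⊗ T)(|c⟩⟨e| ⊗ Q)` the vectors `b` and `c` share exactly the indices in `J ∩ I`. For each
value `s` of these indices the product contributes an operator `|u s⟩⟨v s| ⊗ T Q` over the region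
`J ∪ I`, where `u s` is `a` tensored with the slice at `s` of `T c`, and `v s` is `e` tensored with
the slice at `s` of `Q† b` (`localAtom_mul_localAtom`). The slices of a vector have squared norms
that add up to its squared norm, and `T` acts on `c` only through the sites in `I \ J`, so the
Cauchy–Schwarz inequality bounds `∑ s, ‖u s‖ ‖v s‖` by `‖a‖ ‖b‖ ‖c‖ ‖e‖` times the operator norms
of the `T j` with `j ∈ I \ J` and of the `Q j` with `j ∈ J \ I` (`seminorm_localAtom_mul_le`). On
the distinguished product vectors both sides agree (`localAtom_productVec_mul`).

By induction the optimal product is `c |q⟩⟨q| ⊗ T` over the union `J` of all regions, and every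
admissible product lies in `c` times the absolutely convex hull of the operators `|u⟩⟨v| ⊗ T`
with unit vectors `u`, `v` on `J` and the same `T` (`exists_overlapProduct_bound`). A unitarily
invariant norm takes one and the same value on all these operators (`norm_localAtom`), which gives
the claim.
-/

/-! ### Sums over some of the coordinates -/

section PartialSum

variable {ι : Type*} [DecidableEq ι] {π : ι → Type*} [∀ i, Fintype (π i)]

/-- The sum of `f` over all points that agree with `z` outside `s`. It is the discrete analogue
of an integral over the coordinates in `s`. -/
def partialSum {E : Type*} [AddCommMonoid E] (s : Finset ι) (f : (∀ i, π i) → E)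
    (z : ∀ i, π i) : E :=
  ∑ t : (∀ i : s, π i), f (Function.updateFinset z s t)

theorem partialSum_union {E : Type*} [AddCommMonoid E] {s t : Finset ι} (h : Disjoint s t)
    (f : (∀ i, π i) → E) : partialSum (s ∪ t) f = partialSum s (partialSum t f) := by
  funext z
  simp only [partialSum]
  rw [← (Equiv.piFinsetUnion π h).sum_comp, Fintype.sum_prod_type]
  simp only [Function.updateFinset_updateFinset h]

theorem partialSum_comm {E : Type*} [AddCommMonoid E] {s t : Finset ι} (h : Disjoint s t)
    (f : (∀ i, π i) → E) : partialSum s (partialSum t f) = partialSum t (partialSum s f) := by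
  rw [← partialSum_union h, ← partialSum_union h.symm, Finset.union_comm]

theorem partialSum_empty {E : Type*} [AddCommMonoid E] (f : (∀ i, π i) → E) :
    partialSum ∅ f = f := by
  funext z
  simp [partialSum]

theorem partialSum_singleton {E : Type*} [AddCommMonoid E] (i : ι) (f : (∀ i, π i) → E)
    (z : ∀ i, π i) : partialSum {i} f z = ∑ t : π i, f (Function.update z i t) := by
  rw [partialSum, ← (Equiv.piUnique fun j : ({i} : Finset ι) => π j).symm.sum_comp]
  refine Fintype.sum_congr _ _ fun t => ?_
  rw [Function.updateFinset_singleton]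
  rfl

theorem partialSum_univ {E : Type*} [AddCommMonoid E] [Fintype ι] (f : (∀ i, π i) → E)
    (z : ∀ i, π i) : partialSum Finset.univ f z = ∑ x, f x := by
  rw [partialSum]
  refine Fintype.sum_bijective (fun t i => t ⟨i, Finset.mem_univ i⟩) ⟨?_, ?_⟩ _ _ ?_
  · intro a b hab
    funext i
    exact congrFun hab i
  · intro x
    exact ⟨fun i => x i, rfl⟩
  · intro t
    congr 1
    funext i
    simp [Function.updateFinset]

/-- A factor which does not involve the coordinates in `s` can be pulled out. -/
theorem partialSum_mul_left {E : Type*} [NonUnitalNonAssocSemiring E] {s : Finset ι}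
    {g : (∀ i, π i) → E} {u : Set ι} (hg : DependsOn g u) (hs : Disjoint u s)
    (f : (∀ i, π i) → E) (z : ∀ i, π i) :
    partialSum s (fun x => g x * f x) z = g z * partialSum s f z := by
  rw [partialSum, partialSum, Finset.mul_sum]
  refine Fintype.sum_congr _ _ fun t => ?_
  rw [hg (y := z)]
  intro i hi
  have : i ∉ s := fun h => Set.disjoint_left.1 hs hi h
  simp [Function.updateFinset, this]

theorem partialSum_const_mul {E : Type*} [NonUnitalNonAssocSemiring E] (s : Finset ι) (c : E)
    (f : (∀ i, π i) → E) (z : ∀ i, π i) :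
    partialSum s (fun x => c * f x) z = c * partialSum s f z :=
  (Finset.mul_sum _ _ _).symm

theorem partialSum_dependsOn {E : Type*} [AddCommMonoid E] {s : Finset ι} {u v : Set ι}
    {f : (∀ i, π i) → E} (hf : DependsOn f u) (h : u ⊆ v ∪ s) :
    DependsOn (partialSum s f) v := by
  intro x y hxy
  refine Fintype.sum_congr _ _ fun t => hf fun i hi => ?_
  by_cases his : i ∈ s
  · simp [Function.updateFinset, his]
  · simp [Function.updateFinset, his, hxy i ((h hi).resolve_right his)]

theorem partialSum_comp_restrict {E : Type*} [AddCommMonoid E] (s : Finset ι)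
    (f : (∀ i : s, π i) → E) (z : ∀ i, π i) :
    partialSum s (fun x => f (s.restrict x)) z = ∑ t, f t := by
  refine Fintype.sum_congr _ _ fun t => ?_
  simp only [Function.restrict_updateFinset]

theorem partialSum_mono {s : Finset ι} {f g : (∀ i, π i) → ℝ} (h : ∀ x, f x ≤ g x)
    (z : ∀ i, π i) : partialSum s f z ≤ partialSum s g z :=
  Finset.sum_le_sum fun _ _ => h _

theorem partialSum_prod {E : Type*} [CommSemiring E] (s : Finset ι) (h : ∀ i, π i → E)
    (z : ∀ i, π i) :
    partialSum s (fun x => ∏ i ∈ s, h i (x i)) z = ∏ i ∈ s, ∑ t, h i t := by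
  rw [← Finset.prod_coe_sort s fun i => ∑ t, h i t, Finset.prod_univ_sum, Fintype.piFinset_univ]
  refine Fintype.sum_congr _ _ fun t => ?_
  simp only [← Finset.prod_coe_sort s]
  refine Fintype.prod_congr _ _ fun i => ?_
  simp [Function.updateFinset]

/-- The action on `f` of the product operator `⨂_{i ∈ s} M i`, extended by the identity to the
other coordinates. -/
def applyLocal (s : Finset ι) (M : ∀ i, Matrix (π i) (π i) ℂ) (f : (∀ i, π i) → ℂ)
    (z : ∀ i, π i) : ℂ :=
  partialSum s (fun x => (∏ i ∈ s, M i (z i) (x i)) * f x) z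

theorem applyLocal_union {s t : Finset ι} (h : Disjoint s t) (M : ∀ i, Matrix (π i) (π i) ℂ)
    (f : (∀ i, π i) → ℂ) : applyLocal (s ∪ t) M f = applyLocal s M (applyLocal t M f) := by
  funext z
  rw [applyLocal, partialSum_union h, applyLocal]
  refine Fintype.sum_congr _ _ fun w => ?_
  set z' := Function.updateFinset z s w with hz'
  simp only [applyLocal, partialSum, Finset.mul_sum]
  refine Fintype.sum_congr _ _ fun v => ?_
  rw [Finset.prod_union h, mul_assoc]
  congr 1
  · refine Finset.prod_congr rfl fun i hi => ?_
    have : i ∉ t := fun h' => Finset.disjoint_left.1 h hi h'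
    simp [Function.updateFinset, this]
  · congr 1
    refine Finset.prod_congr rfl fun i hi => ?_
    have : i ∉ s := fun h' => Finset.disjoint_left.1 h h' hi
    simp [hz', Function.updateFinset, this]

theorem partialSum_norm_sq_applyLocal_singleton (i : ι) (M : ∀ i, Matrix (π i) (π i) ℂ) (τ : ℝ)
    (hM : ∀ v : π i → ℂ, ∑ a, ‖(M i).mulVec v a‖ ^ 2 ≤ τ ^ 2 * ∑ a, ‖v a‖ ^ 2)
    (f : (∀ i, π i) → ℂ) (z : ∀ i, π i) :
    partialSum {i} (fun x => ‖applyLocal {i} M f x‖ ^ 2) z ≤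
      τ ^ 2 * partialSum {i} (fun x => ‖f x‖ ^ 2) z := by
  rw [partialSum_singleton, partialSum_singleton]
  refine le_trans (le_of_eq ?_) (hM fun t => f (Function.update z i t))
  refine Fintype.sum_congr _ _ fun a => ?_
  rw [applyLocal, partialSum_singleton]
  simp [Matrix.mulVec, dotProduct]

/-- The operator norm of a product operator is at most the product of the operator norms; the
coordinates are treated one at a time. -/
theorem partialSum_norm_sq_applyLocal_le (s : Finset ι) (M : ∀ i, Matrix (π i) (π i) ℂ)
    (τ : ι → ℝ)
    (hM : ∀ i ∈ s, ∀ v : π i → ℂ, ∑ a, ‖(M i).mulVec v a‖ ^ 2 ≤ τ i ^ 2 * ∑ a, ‖v a‖ ^ 2)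
    (f : (∀ i, π i) → ℂ) (z : ∀ i, π i) :
    partialSum s (fun x => ‖applyLocal s M f x‖ ^ 2) z ≤
      (∏ i ∈ s, τ i) ^ 2 * partialSum s (fun x => ‖f x‖ ^ 2) z := by
  induction s using Finset.induction_on generalizing z with
  | empty => simp [applyLocal, partialSum_empty]
  | insert i s hi ih =>
    have hd : Disjoint {i} s := Finset.disjoint_singleton_left.2 hi
    have ih' := ih fun j hj => hM j (Finset.mem_insert_of_mem hj)
    rw [Finset.insert_eq, applyLocal_union hd, partialSum_union hd, partialSum_comm hd]
    calc _ ≤ partialSum s (fun x => τ i ^ 2 *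
              partialSum {i} (fun x => ‖applyLocal s M f x‖ ^ 2) x) z :=
            partialSum_mono (fun x => partialSum_norm_sq_applyLocal_singleton i M (τ i)
              (hM i (Finset.mem_insert_self i s)) _ x) z
      _ = τ i ^ 2 * partialSum {i} (partialSum s fun x => ‖applyLocal s M f x‖ ^ 2) z := by
            rw [partialSum_comm hd, partialSum_const_mul]
      _ ≤ τ i ^ 2 * partialSum {i}
            (fun x => (∏ i ∈ s, τ i) ^ 2 * partialSum s (fun x => ‖f x‖ ^ 2) x) z :=
            mul_le_mul_of_nonneg_left (partialSum_mono ih' z) (sq_nonneg _)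
      _ = _ := by
            rw [partialSum_union hd, ← Finset.insert_eq, Finset.prod_insert hi, mul_pow, mul_assoc,
              partialSum_const_mul]

end PartialSum

/-! ### Products of operators `|a⟩⟨b| ⊗ T` -/

section Atom

variable {n : ℕ} {d : Fin n → ℕ}

/-- The Euclidean norm of a vector given by its coordinates. -/
noncomputable def vecNorm {κ : Type*} [Fintype κ] (a : κ → ℂ) : ℝ :=
  √(∑ w, ‖a w‖ ^ 2)

theorem vecNorm_nonneg {κ : Type*} [Fintype κ] (a : κ → ℂ) : 0 ≤ vecNorm a :=
  Real.sqrt_nonneg _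

/-- The operator `|a⟩⟨b̄| ⊗ ⨂_{j ∉ J} T j`, where `b̄` is the complex conjugate of `b`. -/
def localAtom (J : Finset (Fin n)) (a b : RegionIndex d J → ℂ)
    (T : ∀ j, Matrix (Fin (d j)) (Fin (d j)) ℂ) : GlobalOp d :=
  Matrix.of fun x y => a (J.restrict x) * b (J.restrict y) * ∏ j ∈ Jᶜ, T j (x j) (y j)

theorem dependsOn_comp_restrict {β : Type*} (I : Finset (Fin n)) (c : RegionIndex d I → β) :
    DependsOn (fun x : (∀ j, Fin (d j)) => c (I.restrict x)) I := by
  intro x y h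
  have : I.restrict x = I.restrict y := funext fun i => h i i.2
  simp only [this]

theorem applyLocal_dependsOn {s I : Finset (Fin n)} (hs : s ⊆ I)
    (T : ∀ j, Matrix (Fin (d j)) (Fin (d j)) ℂ) {f : (∀ j, Fin (d j)) → ℂ} (hf : DependsOn f I) :
    DependsOn (applyLocal s T f) I := by
  intro x y h
  simp only [applyLocal, partialSum]
  refine Fintype.sum_congr _ _ fun t => ?_
  congr 1
  · refine Finset.prod_congr rfl fun i hi => ?_
    rw [h i (hs hi)]
    simp [Function.updateFinset, hi]
  · refine hf fun i hi => ?_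
    simp only [Function.updateFinset]
    split_ifs
    · rfl
    · exact h i hi

/-- The vector obtained from `a ⊗ (⨂_{j ∈ I \ J} T j) c` by fixing the second copy of the
coordinates in `J ∩ I` to be `s`. The coordinates are taken in a region `U` containing `J`;
`z` is an arbitrary base point used to extend a point of the region `U` to all of `[n]`. -/
def joinVec (U J I : Finset (Fin n)) (hU : J ⊆ U) (z : ∀ j, Fin (d j)) (a : RegionIndex d J → ℂ)
    (c : RegionIndex d I → ℂ) (T : ∀ j, Matrix (Fin (d j)) (Fin (d j)) ℂ) {β : Finset (Fin n)}
    (s : RegionIndex d β) (w : RegionIndex d U) : ℂ :=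
  a (Finset.restrict₂ (π := fun j => Fin (d j)) hU w) *
    applyLocal (I \ J) T (fun x => c (I.restrict x))
      (Function.updateFinset (Function.updateFinset z U w) β s)

theorem joinVec_restrict {U J I : Finset (Fin n)} (hU : J ⊆ U) (hI : I ⊆ U) (z : ∀ j, Fin (d j))
    (a : RegionIndex d J → ℂ) (c : RegionIndex d I → ℂ)
    (T : ∀ j, Matrix (Fin (d j)) (Fin (d j)) ℂ) {β : Finset (Fin n)} (s : RegionIndex d β)
    (x : ∀ j, Fin (d j)) :
    joinVec U J I hU z a c T s (U.restrict x) = a (J.restrict x) *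
      applyLocal (I \ J) T (fun x => c (I.restrict x)) (Function.updateFinset x β s) := by
  unfold joinVec
  congr 1
  refine applyLocal_dependsOn Finset.sdiff_subset T (dependsOn_comp_restrict I c) fun i hi => ?_
  simp [Function.updateFinset, hI hi]

/-- The squared norms of the slices `joinVec … s` add up to the squared norm of
`a ⊗ (⨂_{j ∈ I \ J} T j) c`. -/
theorem sum_norm_sq_joinVec_le {U J I : Finset (Fin n)} (hU : J ⊆ U) (hI : I ⊆ U)
    (hJI : U ⊆ J ∪ I) {β : Finset (Fin n)} (hβ : β = J ∩ I) (z : ∀ j, Fin (d j))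
    (a : RegionIndex d J → ℂ) (c : RegionIndex d I → ℂ)
    (T : ∀ j, Matrix (Fin (d j)) (Fin (d j)) ℂ) (τ : Fin n → ℝ)
    (hT : ∀ i, ∀ v : Fin (d i) → ℂ,
      ∑ k, ‖(T i).mulVec v k‖ ^ 2 ≤ τ i ^ 2 * ∑ k, ‖v k‖ ^ 2) :
    ∑ s : RegionIndex d β, ∑ w, ‖joinVec U J I hU z a c T s w‖ ^ 2 ≤
      (∏ j ∈ I \ J, τ j) ^ 2 * ((∑ w, ‖a w‖ ^ 2) * ∑ w, ‖c w‖ ^ 2) := by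
  set W := applyLocal (I \ J) T (fun x => c (I.restrict x))
  have hWd : DependsOn W I :=
    applyLocal_dependsOn Finset.sdiff_subset T (dependsOn_comp_restrict I c)
  have hU' : U = J ∪ I \ J := by
    rw [Finset.union_sdiff_self_eq_union]
    exact hJI.antisymm (Finset.union_subset hU hI)
  have hI' : I = β ∪ I \ J := by
    rw [hβ, Finset.inter_comm, Finset.union_comm, Finset.sdiff_union_inter]
  have hd : Disjoint β (I \ J) := by
    rw [hβ, Finset.inter_comm]
    exact (Finset.disjoint_sdiff_inter I J).symm
  -- for fixed `s` the vector is a tensor product of `a` with a vector on `I \ J`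
  have h1 : ∀ s : RegionIndex d β, ∑ w, ‖joinVec U J I hU z a c T s w‖ ^ 2 =
      (∑ w, ‖a w‖ ^ 2) *
        partialSum (I \ J) (fun x => ‖W (Function.updateFinset x β s)‖ ^ 2) z := by
    intro s
    rw [← partialSum_comp_restrict U _ z]
    simp only [joinVec_restrict hU hI, norm_mul, mul_pow]
    rw [hU', partialSum_union Finset.disjoint_sdiff]
    have h2 : partialSum (I \ J) (fun x => ‖a (J.restrict x)‖ ^ 2 *
          ‖applyLocal (I \ J) T (fun x => c (I.restrict x)) (Function.updateFinset x β s)‖ ^ 2) =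
        fun x => partialSum (I \ J) (fun x => ‖W (Function.updateFinset x β s)‖ ^ 2) x *
          ‖a (J.restrict x)‖ ^ 2 := by
      funext x
      rw [mul_comm]
      refine partialSum_mul_left (u := J) (dependsOn_comp_restrict J fun w => ‖a w‖ ^ 2) ?_ _ x
      exact_mod_cast Finset.disjoint_sdiff
    have h3 : DependsOn
        (partialSum (I \ J) (fun x => ‖W (Function.updateFinset x β s)‖ ^ 2)) ∅ := by
      refine partialSum_dependsOn (u := (I : Set (Fin n)) \ β) (fun x y h => ?_) ?_
      · exact congrArg (‖·‖ ^ 2) (hWd.updateFinset s h)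
      · rw [hβ]
        intro i hi
        simp at hi ⊢
        tauto
    rw [h2, partialSum_mul_left h3 (Set.empty_disjoint _), mul_comm,
      partialSum_comp_restrict (π := fun j => Fin (d j)) J fun w => ‖a w‖ ^ 2]
  have h4 : ∑ s : RegionIndex d β,
      partialSum (I \ J) (fun x => ‖W (Function.updateFinset x β s)‖ ^ 2) z =
      partialSum β (partialSum (I \ J) fun x => ‖W x‖ ^ 2) z := by
    rw [partialSum_comm hd]
    exact Finset.sum_comm
  rw [Finset.sum_congr rfl fun s _ => h1 s, ← Finset.mul_sum, h4]
  have h5 : partialSum β (partialSum (I \ J) fun x => ‖W x‖ ^ 2) z ≤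
      (∏ j ∈ I \ J, τ j) ^ 2 * ∑ w, ‖c w‖ ^ 2 := by
    refine (partialSum_mono (fun x => partialSum_norm_sq_applyLocal_le (I \ J) T τ
      (fun i _ => hT i) _ x) z).trans (le_of_eq ?_)
    rw [partialSum_const_mul, ← partialSum_union hd, ← hI']
    congr 1
    exact partialSum_comp_restrict I (fun w : RegionIndex d I => ‖c w‖ ^ 2) z
  calc _ ≤ (∑ w, ‖a w‖ ^ 2) * ((∏ j ∈ I \ J, τ j) ^ 2 * ∑ w, ‖c w‖ ^ 2) :=
        mul_le_mul_of_nonneg_left h5 (Finset.sum_nonneg fun _ _ => sq_nonneg _)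
    _ = _ := by ring

/-- The product of two operators of the form `|a⟩⟨b| ⊗ T` is a sum of such operators on the union
of the regions. The sum runs over the indices that are contracted between `b` and `c`. -/
theorem localAtom_mul_localAtom (J I : Finset (Fin n)) (z : ∀ j, Fin (d j))
    (a b : RegionIndex d J → ℂ) (c e : RegionIndex d I → ℂ)
    (T Q : ∀ j, Matrix (Fin (d j)) (Fin (d j)) ℂ) :
    localAtom J a b T * localAtom I c e Q = ∑ s : RegionIndex d (J ∩ I),
      localAtom (J ∪ I) (joinVec (J ∪ I) J I Finset.subset_union_left z a c T s)
        (joinVec (J ∪ I) I J Finset.subset_union_right z e b (fun j => (Q j).transpose) s)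
        (fun j => T j * Q j) := by
  ext x y
  rw [Matrix.sum_apply, Matrix.mul_apply]
  simp only [localAtom, Matrix.of_apply]
  simp only [joinVec_restrict Finset.subset_union_left Finset.subset_union_right,
    joinVec_restrict Finset.subset_union_right Finset.subset_union_left]
  set f1 : (∀ j, Fin (d j)) → ℂ := fun z => (∏ j ∈ I \ J, T j (x j) (z j)) * c (I.restrict z)
    with hf1
  set f2 : (∀ j, Fin (d j)) → ℂ := fun z =>
    (∏ j ∈ J \ I, (Q j).transpose (y j) (z j)) * b (J.restrict z) with hf2
  set f3 : (∀ j, Fin (d j)) → ℂ := fun z => ∏ j ∈ (J ∪ I)ᶜ, T j (x j) (z j) * Q j (z j) (y j)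
    with hf3
  set D : ℂ := ∏ j ∈ (J ∪ I)ᶜ, (T j * Q j) (x j) (y j) with hD
  have hJc : Jᶜ = I \ J ∪ (J ∪ I)ᶜ := by ext i; simp; tauto
  have hIc : Iᶜ = J \ I ∪ (J ∪ I)ᶜ := by ext i; simp; tauto
  have hdJ : Disjoint (I \ J) (J ∪ I)ᶜ :=
    Finset.disjoint_left.2 fun i => by simp; tauto
  have hdI : Disjoint (J \ I) (J ∪ I)ᶜ :=
    Finset.disjoint_left.2 fun i => by simp; tauto
  have hF : ∀ z : ∀ j, Fin (d j), (a (J.restrict x) * b (J.restrict z) *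
      ∏ j ∈ Jᶜ, T j (x j) (z j)) * (c (I.restrict z) * e (I.restrict y) *
      ∏ j ∈ Iᶜ, Q j (z j) (y j)) =
      (a (J.restrict x) * e (I.restrict y)) * (f1 z * (f2 z * f3 z)) := by
    intro z
    rw [hJc, hIc, Finset.prod_union hdJ, Finset.prod_union hdI]
    simp only [hf1, hf2, hf3, Finset.prod_mul_distrib, Matrix.transpose_apply]
    ring
  have hf1d : DependsOn f1 I := by
    intro z z' h
    simp only [hf1]
    refine congrArg₂ _ (Finset.prod_congr rfl fun j hj => ?_) (dependsOn_comp_restrict I c h)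
    rw [h j (Finset.sdiff_subset hj)]
  have hf2d : DependsOn f2 J := by
    intro z z' h
    simp only [hf2]
    refine congrArg₂ _ (Finset.prod_congr rfl fun j hj => ?_) (dependsOn_comp_restrict J b h)
    rw [h j (Finset.sdiff_subset hj)]
  -- the summation over all intermediate indices is carried out on `(J ∪ I)ᶜ`, `J \ I` and `I \ J`
  have s1 : partialSum (J ∪ I)ᶜ (fun z => f1 z * (f2 z * f3 z)) =
      fun z => f1 z * (D * f2 z) := by
    funext z
    rw [partialSum_mul_left hf1d, partialSum_mul_left hf2d, hf3,
      partialSum_prod _ fun j k => T j (x j) k * Q j k (y j)]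
    · simp only [hD, Matrix.mul_apply, mul_comm (f2 z)]
    · exact_mod_cast Finset.disjoint_left.2 fun i => by simp; tauto
    · exact_mod_cast Finset.disjoint_left.2 fun i => by simp; tauto
  have s2 : partialSum (J \ I) (fun z => f1 z * (D * f2 z)) =
      fun z => (D * partialSum (J \ I) f2 z) * f1 z := by
    funext z
    rw [partialSum_mul_left hf1d, partialSum_const_mul, mul_comm]
    exact_mod_cast Finset.disjoint_sdiff
  have hg2 : DependsOn (partialSum (J \ I) f2) ↑(J ∩ I) :=
    partialSum_dependsOn hf2d fun i hi => by simp at hi ⊢; tauto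
  have s3 : partialSum (I \ J) (fun z => (D * partialSum (J \ I) f2 z) * f1 z) =
      fun z => (D * partialSum (J \ I) f2 z) * partialSum (I \ J) f1 z := by
    funext z
    refine partialSum_mul_left (u := ↑(J ∩ I)) (fun u v h => ?_) ?_ _ z
    · simp only [hg2 h]
    · exact_mod_cast Finset.disjoint_left.2 fun i => by simp; tauto
  have hu : (Finset.univ : Finset (Fin n)) = (J ∩ I) ∪ ((I \ J) ∪ ((J \ I) ∪ (J ∪ I)ᶜ)) := by
    ext i; simp; tauto
  have hd1 : Disjoint (J ∩ I) ((I \ J) ∪ ((J \ I) ∪ (J ∪ I)ᶜ)) :=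
    Finset.disjoint_left.2 fun i => by simp; tauto
  have hd2 : Disjoint (I \ J) ((J \ I) ∪ (J ∪ I)ᶜ) :=
    Finset.disjoint_left.2 fun i => by simp; tauto
  rw [Finset.sum_congr rfl fun z _ => hF z, ← Finset.mul_sum,
    ← partialSum_univ _ x, hu, partialSum_union hd1, partialSum_union hd2,
    partialSum_union hdI, s1, s2, s3, partialSum, Finset.mul_sum]
  refine Fintype.sum_congr _ _ fun s => ?_
  -- the site operators in `applyLocal` are evaluated at the updated point, which agrees with
  -- `x` on `I \ J` and with `y` on `J \ I`
  have e1 : partialSum (I \ J) f1 (Function.updateFinset x (J ∩ I) s) =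
      applyLocal (I \ J) T (fun x => c (I.restrict x)) (Function.updateFinset x (J ∩ I) s) := by
    rw [applyLocal]
    refine Fintype.sum_congr _ _ fun t => ?_
    simp only [hf1]
    congr 1
    refine Finset.prod_congr rfl fun j hj => ?_
    have : j ∉ J ∩ I := fun h => (Finset.mem_sdiff.1 hj).2 (Finset.mem_inter.1 h).1
    simp only [Function.updateFinset, this, dite_false]
  have e2 : partialSum (J \ I) f2 (Function.updateFinset x (J ∩ I) s) =
      applyLocal (J \ I) (fun j => (Q j).transpose) (fun x => b (J.restrict x))
        (Function.updateFinset y (J ∩ I) s) := by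
    rw [hg2 (y := Function.updateFinset y (J ∩ I) s) fun i hi => by
      simp only [Function.updateFinset, Finset.mem_coe.1 hi, dite_true]]
    rw [applyLocal]
    refine Fintype.sum_congr _ _ fun t => ?_
    simp only [hf2]
    congr 1
    refine Finset.prod_congr rfl fun j hj => ?_
    have : j ∉ J ∩ I := fun h => (Finset.mem_sdiff.1 hj).2 (Finset.mem_inter.1 h).2
    simp only [Function.updateFinset, this, dite_false]
  rw [e1, e2]
  ring

/-- A seminorm that is bounded on the operators `|u⟩⟨v| ⊗ T Q` over the region `J ∪ I` is bounded on
products of operators over the regions `J` and `I`: the Cauchy–Schwarz inequality is applied to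
the sum over the contracted indices. -/
theorem seminorm_localAtom_mul_le (J I : Finset (Fin n)) (z : ∀ j, Fin (d j))
    (T Q : ∀ j, Matrix (Fin (d j)) (Fin (d j)) ℂ) (τ σ : Fin n → ℝ)
    (hτ : ∀ j, 0 ≤ τ j) (hσ : ∀ j, 0 ≤ σ j)
    (hT : ∀ i, ∀ v : Fin (d i) → ℂ,
      ∑ k, ‖(T i).mulVec v k‖ ^ 2 ≤ τ i ^ 2 * ∑ k, ‖v k‖ ^ 2)
    (hQ : ∀ i, ∀ v : Fin (d i) → ℂ,
      ∑ k, ‖(Q i).transpose.mulVec v k‖ ^ 2 ≤ σ i ^ 2 * ∑ k, ‖v k‖ ^ 2)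
    (p : Seminorm ℂ (GlobalOp d)) {M : ℝ} (hM : 0 ≤ M)
    (hp : ∀ u v : RegionIndex d (J ∪ I) → ℂ,
      p (localAtom (J ∪ I) u v fun j => T j * Q j) ≤ M * (vecNorm u * vecNorm v))
    (a b : RegionIndex d J → ℂ) (c e : RegionIndex d I → ℂ) :
    p (localAtom J a b T * localAtom I c e Q) ≤
      M * ((∏ j ∈ I \ J, τ j) * (∏ j ∈ J \ I, σ j)) *
        ((vecNorm a * vecNorm b) * (vecNorm c * vecNorm e)) := by
  rw [localAtom_mul_localAtom J I z]
  set u := joinVec (J ∪ I) J I Finset.subset_union_left z a c T (β := J ∩ I)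
  set v := joinVec (J ∪ I) I J Finset.subset_union_right z e b (fun j => (Q j).transpose)
    (β := J ∩ I)
  have hu : √(∑ s, ∑ w, ‖u s w‖ ^ 2) ≤ (∏ j ∈ I \ J, τ j) * (vecNorm a * vecNorm c) := by
    refine (Real.sqrt_le_sqrt (sum_norm_sq_joinVec_le Finset.subset_union_left
      Finset.subset_union_right subset_rfl rfl z a c T τ hT)).trans (le_of_eq ?_)
    rw [Real.sqrt_mul (sq_nonneg _), Real.sqrt_sq (Finset.prod_nonneg fun j _ => hτ j),
      Real.sqrt_mul (Finset.sum_nonneg fun _ _ => sq_nonneg _)]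
    rfl
  have hv : √(∑ s, ∑ w, ‖v s w‖ ^ 2) ≤ (∏ j ∈ J \ I, σ j) * (vecNorm e * vecNorm b) := by
    refine (Real.sqrt_le_sqrt (sum_norm_sq_joinVec_le Finset.subset_union_right
      Finset.subset_union_left (Finset.union_comm J I).subset (Finset.inter_comm J I) z e b
      (fun j => (Q j).transpose) σ hQ)).trans (le_of_eq ?_)
    rw [Real.sqrt_mul (sq_nonneg _), Real.sqrt_sq (Finset.prod_nonneg fun j _ => hσ j),
      Real.sqrt_mul (Finset.sum_nonneg fun _ _ => sq_nonneg _)]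
    rfl
  calc p (∑ s, localAtom (J ∪ I) (u s) (v s) fun j => T j * Q j)
      ≤ ∑ s, p (localAtom (J ∪ I) (u s) (v s) fun j => T j * Q j) := 
        Finset.le_sum_of_subadditive p (map_zero p).le (map_add_le_add p) _ _
    _ ≤ ∑ s, M * (vecNorm (u s) * vecNorm (v s)) := Finset.sum_le_sum fun s _ => hp _ _
    _ = M * ∑ s, vecNorm (u s) * vecNorm (v s) := by rw [Finset.mul_sum]
    _ ≤ M * (√(∑ s, ∑ w, ‖u s w‖ ^ 2) * √(∑ s, ∑ w, ‖v s w‖ ^ 2)) := by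
        refine mul_le_mul_of_nonneg_left ?_ hM
        exact Real.sum_sqrt_mul_sqrt_le _
          (fun s => Finset.sum_nonneg fun _ _ => sq_nonneg _)
          (fun s => Finset.sum_nonneg fun _ _ => sq_nonneg _)
    _ ≤ M * (((∏ j ∈ I \ J, τ j) * (vecNorm a * vecNorm c)) *
          ((∏ j ∈ J \ I, σ j) * (vecNorm e * vecNorm b))) := by
        refine mul_le_mul_of_nonneg_left ?_ hM
        exact mul_le_mul hu hv (Real.sqrt_nonneg _) (mul_nonneg
          (Finset.prod_nonneg fun j _ => hτ j) (mul_nonneg (vecNorm_nonneg _) (vecNorm_nonneg _)))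
    _ = _ := by ring

end Atom

/-! ### Rank one decompositions, unitaries and singular values -/

section LinearAlgebra

theorem ofReal_sum_norm_sq {κ : Type*} [Fintype κ] (w : κ → ℂ) :
    ((∑ k, ‖w k‖ ^ 2 : ℝ) : ℂ) = star w ⬝ᵥ w := by
  simp [dotProduct, Complex.conj_mul']

theorem vecNorm_eq_norm {κ : Type*} [Fintype κ] (e : EuclideanSpace ℂ κ) :
    vecNorm (fun k => e k) = ‖e‖ :=
  (EuclideanSpace.norm_eq e).symm

theorem vecNorm_star {κ : Type*} [Fintype κ] (a : κ → ℂ) : vecNorm (star a) = vecNorm a := by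
  simp [vecNorm]

open scoped ComplexOrder in
/-- An operator is a sum of rank one operators whose norms add up to its trace norm: apply it to
an orthonormal basis of eigenvectors of its absolute value. -/
theorem exists_eq_sum_vecMulVec {κ : Type*} [Fintype κ] [DecidableEq κ] (R : Matrix κ κ ℂ) :
    ∃ u v : κ → κ → ℂ, R = ∑ k, Matrix.vecMulVec (u k) (v k) ∧
      ∑ k, vecNorm (u k) * vecNorm (v k) = traceNorm R := by
  have hA : (CFC.abs R).PosSemidef := Matrix.nonneg_iff_posSemidef.1 (CFC.abs_nonneg R)
  have hH := hA.isHermitian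
  have hvec : ∀ k, vecNorm (fun i => hH.eigenvectorBasis k i) = 1 := fun k => by
    rw [vecNorm_eq_norm, hH.eigenvectorBasis.norm_eq_one]
  refine ⟨fun k => R.mulVec (hH.eigenvectorBasis k), fun k => star ⇑(hH.eigenvectorBasis k),
    ?_, ?_⟩
  -- `R = R U U*`, where the columns of the unitary `U` are the eigenvectors
  · have h : R = R * ((hH.eigenvectorUnitary : Matrix κ κ ℂ) *
        star (hH.eigenvectorUnitary : Matrix κ κ ℂ)) := by
      rw [Unitary.mul_star_self_of_mem hH.eigenvectorUnitary.2, mul_one]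
    rw [← mul_assoc] at h
    conv_lhs => rw [h]
    ext i j
    rw [Matrix.sum_apply, Matrix.mul_apply]
    rfl
  · rw [traceNorm, hH.trace_eq_sum_eigenvalues]
    simp only [Complex.re_sum]
    refine Fintype.sum_congr _ _ fun k => ?_
    have h1 : vecNorm (star ⇑(hH.eigenvectorBasis k)) = 1 := (vecNorm_star _).trans (hvec k)
    -- `‖R e‖² = ⟨e, R* R e⟩ = ⟨e, |R|² e⟩ = λ²` for an eigenvector `e` of `|R|`
    have h2 : ((∑ i, ‖R.mulVec (hH.eigenvectorBasis k) i‖ ^ 2 : ℝ) : ℂ) =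
        ((hH.eigenvalues k ^ 2 : ℝ) : ℂ) := by
      rw [ofReal_sum_norm_sq, Matrix.star_mulVec, ← Matrix.dotProduct_mulVec,
        Matrix.mulVec_mulVec, ← Matrix.star_eq_conjTranspose, ← CFC.abs_mul_abs,
        ← Matrix.mulVec_mulVec, hH.mulVec_eigenvectorBasis, Matrix.mulVec_smul,
        hH.mulVec_eigenvectorBasis, smul_smul, dotProduct_smul, ← ofReal_sum_norm_sq]
      have h3 := hvec k
      rw [vecNorm, Real.sqrt_eq_one] at h3
      rw [h3]
      simp [sq]
    rw [h1, mul_one, vecNorm, Complex.ofReal_injective h2, Real.sqrt_sq (hA.eigenvalues_nonneg k)]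
    simp

/-- Every vector is its norm times the image of a given basis vector under a unitary. -/
theorem exists_unitary_mulVec_single {κ : Type*} [Fintype κ] [DecidableEq κ] (i : κ)
    (a : κ → ℂ) : ∃ U ∈ Matrix.unitaryGroup κ ℂ,
      a = (vecNorm a : ℂ) • U.mulVec (Pi.single i 1) := by
  by_cases ha : vecNorm a = 0
  · refine ⟨1, one_mem _, ?_⟩
    rw [ha]
    have h := (vecNorm_eq_norm (WithLp.toLp 2 a)).symm.trans ha
    rw [norm_eq_zero] at h
    simpa using h
  · set e : EuclideanSpace ℂ κ := (vecNorm a : ℂ)⁻¹ • WithLp.toLp 2 a with he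
    have hn : ‖e‖ = 1 := by
      rw [he, norm_smul, ← vecNorm_eq_norm (WithLp.toLp 2 a), norm_inv, Complex.norm_real,
        Real.norm_of_nonneg (vecNorm_nonneg a)]
      exact inv_mul_cancel₀ ha
    have ho : Orthonormal ℂ (({i} : Set κ).domRestrict fun _ => e) := by
      refine ⟨fun _ => hn, fun j k hjk => (hjk (Subsingleton.elim j k)).elim⟩
    obtain ⟨b, hb⟩ := ho.exists_orthonormalBasis_extension_of_card_eq (by simp)
    refine ⟨(EuclideanSpace.basisFun κ ℂ).toBasis.toMatrix b,
      (EuclideanSpace.basisFun κ ℂ).toMatrix_orthonormalBasis_mem_unitary b, ?_⟩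
    funext k
    have hb' : b i = e := hb i rfl
    have hc : (vecNorm a : ℂ) ≠ 0 := by exact_mod_cast ha
    simp [Module.Basis.toMatrix_apply, hb', he, hc]

theorem sum_norm_sq_toEuclideanLin_le {m : ℕ} (A : Matrix (Fin m) (Fin m) ℂ)
    (v : EuclideanSpace ℂ (Fin m)) :
    ‖Matrix.toEuclideanLin A v‖ ^ 2 ≤ largestSingularValue A ^ 2 * ‖v‖ ^ 2 := by
  set T := Matrix.toEuclideanLin A
  have hn : Module.finrank ℂ (EuclideanSpace ℂ (Fin m)) = m := by simp
  set b := T.isSymmetric_adjoint_comp_self.eigenvectorBasis hn with hb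
  have h1 : ‖T v‖ ^ 2 = ∑ i : Fin m, T.singularValues i ^ 2 * ‖inner ℂ (b i) v‖ ^ 2 := by
    have h2 : ((‖T v‖ ^ 2 : ℝ) : ℂ) = inner ℂ v ((T.adjoint ∘ₗ T) v) := by
      rw [LinearMap.comp_apply, LinearMap.adjoint_inner_right, inner_self_eq_norm_sq_to_K]
      simp
    apply Complex.ofReal_injective
    rw [h2, ← b.sum_inner_mul_inner, Complex.ofReal_sum]
    refine Fintype.sum_congr _ _ fun i => ?_
    have h3 : inner ℂ (b i) ((T.adjoint ∘ₗ T) v) =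
        ((T.singularValues i ^ 2 : ℝ) : ℂ) * inner ℂ (b i) v := by
      rw [← T.isSymmetric_adjoint_comp_self (b i) v, hb,
        LinearMap.IsSymmetric.apply_eigenvectorBasis, inner_smul_left,
        T.sq_singularValues_fin hn i]
      simp
    rw [h3, ← inner_conj_symm, mul_left_comm, Complex.conj_mul']
    push_cast
    rfl
  rw [h1, ← b.sum_sq_norm_inner_right v, Finset.mul_sum]
  refine Finset.sum_le_sum fun i _ => mul_le_mul_of_nonneg_right ?_ (sq_nonneg _)
  exact pow_le_pow_left₀ (T.singularValues_nonneg i) (T.singularValues_antitone (Nat.zero_le _)) 2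

open scoped Matrix.Norms.L2Operator in
theorem l2_opNorm_le_largestSingularValue {m : ℕ} (A : Matrix (Fin m) (Fin m) ℂ) :
    ‖A‖ ≤ largestSingularValue A := by
  have h0 : 0 ≤ largestSingularValue A := LinearMap.singularValues_nonneg _ 0
  rw [Matrix.cstar_norm_def]
  refine ContinuousLinearMap.opNorm_le_bound _ h0 fun v => ?_
  refine le_of_sq_le_sq ?_ (mul_nonneg h0 (norm_nonneg v))
  rw [mul_pow]
  exact sum_norm_sq_toEuclideanLin_le A v

open scoped Matrix.Norms.L2Operator in
theorem sum_norm_sq_mulVec_le_l2_opNorm {m : ℕ} (A : Matrix (Fin m) (Fin m) ℂ)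
    (v : Fin m → ℂ) : ∑ k, ‖A.mulVec v k‖ ^ 2 ≤ ‖A‖ ^ 2 * ∑ k, ‖v k‖ ^ 2 := by
  have h := pow_le_pow_left₀ (norm_nonneg _) (Matrix.l2_opNorm_mulVec A (WithLp.toLp 2 v)) 2
  rw [mul_pow, EuclideanSpace.norm_sq_eq, EuclideanSpace.norm_sq_eq] at h
  exact h

open scoped Matrix.Norms.L2Operator in
theorem sum_norm_sq_mulVec_le {m : ℕ} (A : Matrix (Fin m) (Fin m) ℂ) (v : Fin m → ℂ) :
    ∑ k, ‖A.mulVec v k‖ ^ 2 ≤ largestSingularValue A ^ 2 * ∑ k, ‖v k‖ ^ 2 := by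
  refine (sum_norm_sq_mulVec_le_l2_opNorm A v).trans
    (mul_le_mul_of_nonneg_right ?_ (Finset.sum_nonneg fun _ _ => sq_nonneg _))
  exact pow_le_pow_left₀ (norm_nonneg A) (l2_opNorm_le_largestSingularValue A) 2

open scoped Matrix.Norms.L2Operator in
theorem sum_norm_sq_transpose_mulVec_le {m : ℕ} (A : Matrix (Fin m) (Fin m) ℂ)
    (v : Fin m → ℂ) :
    ∑ k, ‖A.transpose.mulVec v k‖ ^ 2 ≤ largestSingularValue A ^ 2 * ∑ k, ‖v k‖ ^ 2 := by
  have h1 : A.transpose.mulVec v = star (A.conjTranspose.mulVec (star v)) := by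
    rw [Matrix.star_mulVec, star_star, Matrix.conjTranspose_conjTranspose,
      Matrix.mulVec_transpose]
  have h2 := sum_norm_sq_mulVec_le_l2_opNorm A.conjTranspose (star v)
  rw [Matrix.l2_opNorm_conjTranspose] at h2
  simp only [Pi.star_apply, norm_star] at h2
  rw [h1]
  simp only [Pi.star_apply, norm_star]
  refine h2.trans (mul_le_mul_of_nonneg_right ?_ (Finset.sum_nonneg fun _ _ => sq_nonneg _))
  exact pow_le_pow_left₀ (norm_nonneg A) (l2_opNorm_le_largestSingularValue A) 2

end LinearAlgebra

/-! ### Tensor products over a region and its complement -/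

section RegionTensor

variable {n : ℕ} {d : Fin n → ℕ}

theorem sum_mul_comp_restrict (J : Finset (Fin n)) (f : RegionIndex d J → ℂ)
    (g : RegionIndex d Jᶜ → ℂ) (x : ∀ j, Fin (d j)) :
    ∑ z : (∀ j, Fin (d j)), f (J.restrict z) * g (Jᶜ.restrict z) = (∑ w, f w) * ∑ w, g w := by
  rw [← partialSum_univ _ x, ← Finset.union_compl J, partialSum_union disjoint_compl_right]
  have h : partialSum Jᶜ (fun z : (∀ j, Fin (d j)) => f (J.restrict z) * g (Jᶜ.restrict z)) =
      fun z => (∑ w, g w) * f (J.restrict z) := by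
    funext z
    rw [partialSum_mul_left (dependsOn_comp_restrict J f), mul_comm]
    · congr 1
      exact partialSum_comp_restrict Jᶜ g z
    · exact_mod_cast (disjoint_compl_right : Disjoint J Jᶜ)
  rw [h, partialSum_const_mul, mul_comm]
  congr 1
  exact partialSum_comp_restrict J f x

theorem regionTensor_mul (J : Finset (Fin n)) (R R' : RegionOp d J) (S S' : RegionOp d Jᶜ) :
    regionTensor J R S * regionTensor J R' S' = regionTensor J (R * R') (S * S') := by
  ext x y
  simp only [regionTensor, Matrix.mul_apply, Matrix.of_apply]
  rw [← sum_mul_comp_restrict J (fun w => R (J.restrict x) w * R' w (J.restrict y)) _ x]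
  exact Fintype.sum_congr _ _ fun z => by ring

theorem regionTensor_one (J : Finset (Fin n)) :
    regionTensor J (1 : RegionOp d J) (1 : RegionOp d Jᶜ) = 1 := by
  ext x y
  simp only [regionTensor, Matrix.of_apply, Matrix.one_apply]
  have h : x = y ↔ J.restrict x = J.restrict y ∧ Jᶜ.restrict x = Jᶜ.restrict y := by
    refine ⟨fun h => by simp [h], fun h => funext fun j => ?_⟩
    by_cases hj : j ∈ J
    · exact congrFun h.1 ⟨j, hj⟩
    · exact congrFun h.2 ⟨j, Finset.mem_compl.2 hj⟩
  by_cases h1 : J.restrict x = J.restrict y <;> by_cases h2 : Jᶜ.restrict x = Jᶜ.restrict y <;>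
    simp [h, h1, h2]

theorem regionTensor_conjTranspose (J : Finset (Fin n)) (R : RegionOp d J) (S : RegionOp d Jᶜ) :
    (regionTensor J R S).conjTranspose = regionTensor J R.conjTranspose S.conjTranspose := by
  ext x y
  simp [regionTensor]

theorem regionTensor_one_mem_unitaryGroup (J : Finset (Fin n)) {U : RegionOp d J}
    (hU : U ∈ Matrix.unitaryGroup (RegionIndex d J) ℂ) :
    regionTensor J U 1 ∈ Matrix.unitaryGroup (∀ j, Fin (d j)) ℂ := by
  rw [Matrix.mem_unitaryGroup_iff, Matrix.star_eq_conjTranspose] at hU ⊢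
  rw [regionTensor_conjTranspose, regionTensor_mul, hU, Matrix.conjTranspose_one, mul_one,
    regionTensor_one]

theorem regionTensor_vecMulVec_productOp (J : Finset (Fin n)) (a b : RegionIndex d J → ℂ)
    (Q : (j : ↥Jᶜ) → Matrix (Fin (d j)) (Fin (d j)) ℂ)
    (T : ∀ j, Matrix (Fin (d j)) (Fin (d j)) ℂ) (hT : ∀ j : ↥Jᶜ, T j = Q j) :
    regionTensor J (Matrix.vecMulVec a b) (productOp Q) = localAtom J a b T := by
  ext x y
  simp only [regionTensor, productOp, localAtom, Matrix.of_apply, Matrix.vecMulVec_apply]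
  rw [← Finset.prod_coe_sort Jᶜ]
  simp only [hT]
  rfl

theorem regionTensor_sum {κ : Type*} [Fintype κ] (J : Finset (Fin n)) (R : κ → RegionOp d J)
    (S : RegionOp d Jᶜ) : regionTensor J (∑ k, R k) S = ∑ k, regionTensor J (R k) S := by
  ext x y
  simp only [regionTensor, Matrix.sum_apply, Matrix.of_apply, Finset.sum_mul]

/-- All operators `|a⟩⟨b̄| ⊗ T` with vectors of the same norms are equivalent under local unitaries,
so a unitarily invariant norm only depends on the norms of `a` and `b`. -/
theorem norm_localAtom {N : Seminorm ℂ (GlobalOp d)} (hN : IsUnitarilyInvariantNorm N)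
    (J : Finset (Fin n)) (i : RegionIndex d J) (T : ∀ j, Matrix (Fin (d j)) (Fin (d j)) ℂ)
    (a b : RegionIndex d J → ℂ) :
    N (localAtom J a b T) = vecNorm a * vecNorm b *
      N (localAtom J (Pi.single i 1) (Pi.single i 1) T) := by
  obtain ⟨U, hU, ha⟩ := exists_unitary_mulVec_single i a
  obtain ⟨V, hV, hb⟩ := exists_unitary_mulVec_single i (star b)
  have hb' : b = (vecNorm b : ℂ) • Matrix.vecMul (Pi.single i 1) (star V) := by
    have h := congrArg star hb
    rw [star_star, vecNorm_star, star_smul, Matrix.star_mulVec] at h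
    refine h.trans ?_
    simp [Matrix.star_eq_conjTranspose]
  have h : localAtom J a b T = ((vecNorm a * vecNorm b : ℝ) : ℂ) • (regionTensor J U 1 *
      localAtom J (Pi.single i 1) (Pi.single i 1) T * regionTensor J (star V) 1) := by
    rw [← regionTensor_vecMulVec_productOp J _ _ (fun j => T j) T fun _ => rfl,
      ← regionTensor_vecMulVec_productOp J _ _ (fun j => T j) T fun _ => rfl,
      regionTensor_mul, regionTensor_mul, one_mul, mul_one, Matrix.mul_vecMulVec,
      Matrix.vecMulVec_mul]
    conv_lhs => rw [ha, hb', Matrix.smul_vecMulVec, Matrix.vecMulVec_smul, smul_smul]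
    ext x y
    simp [regionTensor, mul_assoc]
  rw [h, map_smul_eq_mul, hN.invariant _ (regionTensor_one_mem_unitaryGroup J hU) _
    (regionTensor_one_mem_unitaryGroup J (Unitary.star_mem hV)), Complex.norm_real,
    Real.norm_of_nonneg (mul_nonneg (vecNorm_nonneg a) (vecNorm_nonneg b))]

end RegionTensor

/-! ### Site factors with a distinguished eigenvector -/

section LocalFactor

/-- The properties of `α |q⟩⟨q| ⊕ W` with largest singular value `α` that are stable under
products: `q` is an eigenvector on both sides with eigenvalue `τ`, and the operator norms of the
matrix and of its transpose are at most `τ`. -/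
structure IsLocalFactor {m : ℕ} (q : EuclideanSpace ℂ (Fin m)) (τ : ℝ)
    (T : Matrix (Fin m) (Fin m) ℂ) : Prop where
  nonneg : 0 ≤ τ
  mulVec_eq : T.mulVec (fun a => q a) = (τ : ℂ) • fun a => q a
  vecMul_eq : Matrix.vecMul (fun a => star (q a)) T = (τ : ℂ) • fun a => star (q a)
  bound : ∀ v : Fin m → ℂ, ∑ k, ‖T.mulVec v k‖ ^ 2 ≤ τ ^ 2 * ∑ k, ‖v k‖ ^ 2
  bound_transpose : ∀ v : Fin m → ℂ,
    ∑ k, ‖T.transpose.mulVec v k‖ ^ 2 ≤ τ ^ 2 * ∑ k, ‖v k‖ ^ 2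

variable {m : ℕ} {q : EuclideanSpace ℂ (Fin m)}

theorem IsLocalFactor.one : IsLocalFactor q 1 1 := by
  constructor <;> simp

theorem IsLocalFactor.mul {τ σ : ℝ} {T S : Matrix (Fin m) (Fin m) ℂ} (hT : IsLocalFactor q τ T)
    (hS : IsLocalFactor q σ S) : IsLocalFactor q (τ * σ) (T * S) where
  nonneg := mul_nonneg hT.nonneg hS.nonneg
  mulVec_eq := by
    rw [← Matrix.mulVec_mulVec, hS.mulVec_eq, Matrix.mulVec_smul, hT.mulVec_eq, smul_smul]
    push_cast
    rw [mul_comm]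
  vecMul_eq := by
    rw [← Matrix.vecMul_vecMul, hT.vecMul_eq, Matrix.smul_vecMul, hS.vecMul_eq, smul_smul]
    push_cast
    rfl
  bound v := by
    rw [← Matrix.mulVec_mulVec, mul_pow, mul_assoc]
    exact (hT.bound _).trans (mul_le_mul_of_nonneg_left (hS.bound v) (sq_nonneg _))
  bound_transpose v := by
    rw [Matrix.transpose_mul, ← Matrix.mulVec_mulVec, mul_comm τ, mul_pow, mul_assoc]
    exact (hS.bound_transpose _).trans
      (mul_le_mul_of_nonneg_left (hT.bound_transpose v) (sq_nonneg _))

theorem star_dotProduct_self_of_norm_eq_one (hq : ‖q‖ = 1) :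
    (fun a => star (q a)) ⬝ᵥ (fun a => q a) = 1 := by
  have h := ofReal_sum_norm_sq fun a => q a
  rw [← EuclideanSpace.norm_sq_eq, hq, one_pow, Complex.ofReal_one] at h
  exact h.symm

theorem IsBlockForm.isLocalFactor (hq : ‖q‖ = 1) {α : ℝ} {A : Matrix (Fin m) (Fin m) ℂ}
    (hA : IsBlockForm q α A) (hα : largestSingularValue A = α) : IsLocalFactor q α A := by
  have hqq := star_dotProduct_self_of_norm_eq_one hq
  refine ⟨?_, ?_, ?_, ?_, ?_⟩
  · exact hα ▸ LinearMap.singularValues_nonneg _ 0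
  · obtain ⟨W, h1, -, rfl⟩ := hA
    rw [Matrix.add_mulVec, h1, add_zero, Matrix.smul_mulVec, ketbra, Matrix.vecMulVec_mulVec, hqq]
    simp
  · obtain ⟨W, -, h2, rfl⟩ := hA
    rw [Matrix.vecMul_add, h2, add_zero, Matrix.vecMul_smul, ketbra, Matrix.vecMul_vecMulVec, hqq]
    simp
  · exact hα ▸ sum_norm_sq_mulVec_le A
  · exact hα ▸ sum_norm_sq_transpose_mulVec_le A

theorem IsLocalFactor.mul_ketbra {τ : ℝ} {T : Matrix (Fin m) (Fin m) ℂ}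
    (hT : IsLocalFactor q τ T) : T * ketbra q = (τ : ℂ) • ketbra q := by
  rw [ketbra, Matrix.mul_vecMulVec, hT.mulVec_eq, Matrix.smul_vecMulVec]

theorem IsLocalFactor.ketbra_mul {τ : ℝ} {T : Matrix (Fin m) (Fin m) ℂ}
    (hT : IsLocalFactor q τ T) : ketbra q * T = (τ : ℂ) • ketbra q := by
  rw [ketbra, Matrix.vecMulVec_mul, hT.vecMul_eq, Matrix.vecMulVec_smul]

theorem ketbra_mul_ketbra (hq : ‖q‖ = 1) : ketbra q * ketbra q = ketbra q := by
  rw [ketbra, Matrix.vecMulVec_mul_vecMulVec, star_dotProduct_self_of_norm_eq_one hq]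
  simp

end LocalFactor

/-! ### Distinguished product vectors -/

section ProductVector

variable {n : ℕ} {d : Fin n → ℕ}

/-- The operator `⨂_{j ∈ [n]} M j`. -/
def siteProduct (M : ∀ j, Matrix (Fin (d j)) (Fin (d j)) ℂ) : GlobalOp d :=
  Matrix.of fun x y => ∏ j, M j (x j) (y j)

theorem siteProduct_mul (M M' : ∀ j, Matrix (Fin (d j)) (Fin (d j)) ℂ) :
    siteProduct M * siteProduct M' = siteProduct fun j => M j * M' j := by
  ext x y
  simp only [siteProduct, Matrix.mul_apply, Matrix.of_apply, Finset.prod_univ_sum,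
    Fintype.piFinset_univ, Finset.prod_mul_distrib]

theorem siteProduct_smul (c : Fin n → ℂ) (M : ∀ j, Matrix (Fin (d j)) (Fin (d j)) ℂ) :
    siteProduct (fun j => c j • M j) = (∏ j, c j) • siteProduct M := by
  ext x y
  simp [siteProduct, Finset.prod_mul_distrib]

theorem siteProduct_one :
    siteProduct (fun j => (1 : Matrix (Fin (d j)) (Fin (d j)) ℂ)) = 1 := by
  ext x y
  simp only [siteProduct, Matrix.of_apply, Matrix.one_apply, Finset.prod_ite_zero,
    Finset.prod_const_one, funext_iff, Finset.mem_univ, true_imp_iff]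

/-- The product vector `⨂_{j ∈ J} q j`. -/
def productVec (J : Finset (Fin n)) (q : ∀ j, EuclideanSpace ℂ (Fin (d j)))
    (w : RegionIndex d J) : ℂ :=
  ∏ j : ↥J, q j (w j)

theorem productOp_ketbra (J : Finset (Fin n)) (q : ∀ j, EuclideanSpace ℂ (Fin (d j))) :
    productOp (fun j : ↥J => ketbra (q j)) =
      Matrix.vecMulVec (productVec J q) (star (productVec J q)) := by
  ext x y
  simp [productOp, ketbra, Matrix.vecMulVec_apply, productVec, Finset.prod_mul_distrib]

theorem vecNorm_productVec (J : Finset (Fin n)) (q : ∀ j, EuclideanSpace ℂ (Fin (d j)))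
    (hq : ∀ j, ‖q j‖ = 1) : vecNorm (productVec J q) = 1 := by
  rw [vecNorm, Real.sqrt_eq_one]
  simp only [productVec, norm_prod, ← Finset.prod_pow]
  rw [← Fintype.piFinset_univ, ← Finset.prod_univ_sum (fun _ => Finset.univ)
    (fun (j : ↥J) (k : Fin (d j)) => ‖q j k‖ ^ 2)]
  refine Finset.prod_eq_one fun j _ => ?_
  rw [← EuclideanSpace.norm_sq_eq, hq, one_pow]

open scoped ComplexOrder in
theorem traceNorm_productOp_ketbra (J : Finset (Fin n)) (q : ∀ j, EuclideanSpace ℂ (Fin (d j)))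
    (hq : ∀ j, ‖q j‖ = 1) : traceNorm (productOp fun j : ↥J => ketbra (q j)) = 1 := by
  rw [productOp_ketbra, traceNorm, CFC.abs_of_nonneg _
    (Matrix.nonneg_iff_posSemidef.2 (Matrix.posSemidef_vecMulVec_self_star _)),
    Matrix.trace_vecMulVec, dotProduct_comm, ← ofReal_sum_norm_sq, Complex.ofReal_re]
  exact Real.sqrt_eq_one.1 (vecNorm_productVec J q hq)

theorem localAtom_productVec (J : Finset (Fin n)) (q : ∀ j, EuclideanSpace ℂ (Fin (d j)))
    (T : ∀ j, Matrix (Fin (d j)) (Fin (d j)) ℂ) :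
    localAtom J (productVec J q) (star (productVec J q)) T =
      siteProduct fun j => if j ∈ J then ketbra (q j) else T j := by
  ext x y
  simp only [localAtom, siteProduct, Matrix.of_apply, productVec, Pi.star_apply, star_prod]
  rw [← Finset.prod_mul_prod_compl J, ← Finset.prod_mul_distrib, ← Finset.prod_coe_sort J]
  congr 1
  · refine Fintype.prod_congr _ _ fun j => ?_
    simp [ketbra, Matrix.vecMulVec_apply]
  · refine Finset.prod_congr rfl fun j hj => ?_
    rw [if_neg (Finset.mem_compl.1 hj)]

/-- On the distinguished product vectors the bound `seminorm_localAtom_mul_le` is attained. -/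
theorem localAtom_productVec_mul (J I : Finset (Fin n)) (q : ∀ j, EuclideanSpace ℂ (Fin (d j)))
    (hq : ∀ j, ‖q j‖ = 1) {T Q : ∀ j, Matrix (Fin (d j)) (Fin (d j)) ℂ} {τ σ : Fin n → ℝ}
    (hT : ∀ j, IsLocalFactor (q j) (τ j) (T j)) (hQ : ∀ j, IsLocalFactor (q j) (σ j) (Q j)) :
    localAtom J (productVec J q) (star (productVec J q)) T *
        localAtom I (productVec I q) (star (productVec I q)) Q =
      (((∏ j ∈ I \ J, τ j) * (∏ j ∈ J \ I, σ j) : ℝ) : ℂ) •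
        localAtom (J ∪ I) (productVec (J ∪ I) q) (star (productVec (J ∪ I) q))
          fun j => T j * Q j := by
  simp only [localAtom_productVec]
  have hc : (((∏ j ∈ I \ J, τ j) * (∏ j ∈ J \ I, σ j) : ℝ) : ℂ) =
      ∏ j, ((if j ∈ I \ J then (τ j : ℂ) else 1) * if j ∈ J \ I then (σ j : ℂ) else 1) := by
    rw [Finset.prod_mul_distrib, Fintype.prod_ite_mem, Fintype.prod_ite_mem]
    push_cast
    rfl
  rw [siteProduct_mul, hc, ← siteProduct_smul]
  congr 1
  funext j
  by_cases hJ : j ∈ J <;> by_cases hI : j ∈ I <;>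
    simp [hJ, hI, ketbra_mul_ketbra (hq j), (hT j).mul_ketbra, (hQ j).ketbra_mul]

end ProductVector

/-! ### Products over several regions -/

section OverlapProduct

variable {n : ℕ} {d : Fin n → ℕ}

/-- The factors `Q j`, `j ∉ I`, completed by identities to a family over all sites. -/
def extendFactor (I : Finset (Fin n)) (Q : (j : ↥Iᶜ) → Matrix (Fin (d j)) (Fin (d j)) ℂ)
    (j : Fin n) : Matrix (Fin (d j)) (Fin (d j)) ℂ :=
  if h : j ∈ Iᶜ then Q ⟨j, h⟩ else 1

theorem extendFactor_coe (I : Finset (Fin n))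
    (Q : (j : ↥Iᶜ) → Matrix (Fin (d j)) (Fin (d j)) ℂ) (j : ↥Iᶜ) :
    extendFactor I Q j = Q j :=
  dif_pos j.2

theorem isLocalFactor_extendFactor {q : ∀ j, EuclideanSpace ℂ (Fin (d j))} (I : Finset (Fin n))
    {α : ↥Iᶜ → ℝ} {Q : (j : ↥Iᶜ) → Matrix (Fin (d j)) (Fin (d j)) ℂ}
    (hQ : ∀ j : ↥Iᶜ, IsLocalFactor (q j) (α j) (Q j)) (j : Fin n) :
    IsLocalFactor (q j) (if h : j ∈ Iᶜ then α ⟨j, h⟩ else 1) (extendFactor I Q j) := by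
  unfold extendFactor
  split_ifs with h
  · exact hQ ⟨j, h⟩
  · exact IsLocalFactor.one

/-- The optimal product is `c · |q⟩⟨q|^{⊗ J} ⊗ T`, where `J` is the union of the regions, and every
other admissible product lies in `c` times the closed absolutely convex hull of the operators
`|u⟩⟨v| ⊗ T` with unit vectors `u`, `v` on `J`. The hull is described by the seminorms that are
bounded on these operators, which makes the induction on the number of regions immediate: the
left factor is absorbed into the seminorm. -/
theorem exists_overlapProduct_bound {q : ∀ j, EuclideanSpace ℂ (Fin (d j))}
    (hq : ∀ j, ‖q j‖ = 1) (z : ∀ j, Fin (d j)) {ℓ : ℕ} (I : Fin ℓ → Finset (Fin n))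
    (α : (i : Fin ℓ) → ↥(I i)ᶜ → ℝ)
    (Q : (i : Fin ℓ) → (j : ↥(I i)ᶜ) → Matrix (Fin (d j)) (Fin (d j)) ℂ)
    (hQ : ∀ i (j : ↥(I i)ᶜ), IsLocalFactor (q j) (α i j) (Q i j)) :
    ∃ (J : Finset (Fin n)) (T : ∀ j, Matrix (Fin (d j)) (Fin (d j)) ℂ) (τ : Fin n → ℝ) (c : ℝ),
      0 ≤ c ∧ (∀ j, IsLocalFactor (q j) (τ j) (T j)) ∧
      overlapProduct I Q (fun i => productOp fun j : ↥(I i) => ketbra (q j)) =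
        (c : ℂ) • localAtom J (productVec J q) (star (productVec J q)) T ∧
      ∀ (p : Seminorm ℂ (GlobalOp d)) (M : ℝ), 0 ≤ M →
        (∀ u v : RegionIndex d J → ℂ, p (localAtom J u v T) ≤ M * (vecNorm u * vecNorm v)) →
        ∀ R : (i : Fin ℓ) → RegionOp d (I i), (∀ i, traceNorm (R i) ≤ 1) →
          p (overlapProduct I Q R) ≤ M * c := by
  induction ℓ with
  | zero =>
    have h1 : localAtom ∅ (productVec ∅ q) (star (productVec ∅ q)) (fun _ => 1) =
        (1 : GlobalOp d) := by
      rw [localAtom_productVec]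
      simpa using siteProduct_one
    refine ⟨∅, fun _ => 1, fun _ => 1, 1, zero_le_one, fun _ => IsLocalFactor.one, ?_, ?_⟩
    · rw [h1]
      simp [overlapProduct]
    · intro p M _ hp R _
      have h2 := hp (productVec ∅ q) (star (productVec ∅ q))
      rw [vecNorm_star, vecNorm_productVec ∅ q hq, mul_one, h1] at h2
      simpa [overlapProduct] using h2
  | succ ℓ ih =>
    obtain ⟨J, T, τ, c, hc, hT, hopt, hbd⟩ := ih (fun i => I i.succ) (fun i => α i.succ)
      (fun i => Q i.succ) fun i => hQ i.succ
    set S := extendFactor (I 0) (Q 0)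
    set σ : Fin n → ℝ := fun j => if h : j ∈ (I 0)ᶜ then α 0 ⟨j, h⟩ else 1
    have hSσ : ∀ j, IsLocalFactor (q j) (σ j) (S j) := isLocalFactor_extendFactor (I 0) (hQ 0)
    set k : ℝ := (∏ j ∈ J \ I 0, σ j) * ∏ j ∈ I 0 \ J, τ j with hk
    have hk0 : 0 ≤ k := mul_nonneg (Finset.prod_nonneg fun j _ => (hSσ j).nonneg)
      (Finset.prod_nonneg fun j _ => (hT j).nonneg)
    have hcons : ∀ R : (i : Fin (ℓ + 1)) → RegionOp d (I i), overlapProduct I Q R =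
        regionTensor (I 0) (R 0) (productOp (Q 0)) *
          overlapProduct (fun i => I i.succ) (fun i => Q i.succ) fun i => R i.succ := by
      intro R
      simp only [overlapProduct, List.ofFn_succ, List.prod_cons]
    refine ⟨I 0 ∪ J, fun j => S j * T j, fun j => σ j * τ j, k * c, mul_nonneg hk0 hc,
      fun j => (hSσ j).mul (hT j), ?_, ?_⟩
    · rw [hcons, hopt, productOp_ketbra, regionTensor_vecMulVec_productOp (I 0) _ _ _ S
        (extendFactor_coe _ _), Matrix.mul_smul, localAtom_productVec_mul (I 0) J q hq hSσ hT,
        smul_smul, ← hk, mul_comm, ← Complex.ofReal_mul]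
    · intro p M hM hp R hR
      obtain ⟨u, v, hRuv, hsum⟩ := exists_eq_sum_vecMulVec (R 0)
      set Y := overlapProduct (fun i => I i.succ) (fun i => Q i.succ) fun i => R i.succ
      have hterm : ∀ w, p (localAtom (I 0) (u w) (v w) S * Y) ≤
          M * k * c * (vecNorm (u w) * vecNorm (v w)) := by
        intro w
        -- the seminorm `Y ↦ p (X * Y)`, where `X` is the leftmost factor
        have h := hbd (p.comp (LinearMap.mulLeft ℂ (localAtom (I 0) (u w) (v w) S)))
          (M * k * (vecNorm (u w) * vecNorm (v w)))
          (mul_nonneg (mul_nonneg hM hk0) (mul_nonneg (vecNorm_nonneg _) (vecNorm_nonneg _)))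
          (fun a b => by
            rw [Seminorm.comp_apply, LinearMap.mulLeft_apply]
            exact (seminorm_localAtom_mul_le (I 0) J z S T σ τ (fun j => (hSσ j).nonneg)
              (fun j => (hT j).nonneg) (fun j => (hSσ j).bound)
              (fun j => (hT j).bound_transpose) p hM hp _ _ _ _).trans_eq (by ring))
          (fun i => R i.succ) fun i => hR i.succ
        rw [Seminorm.comp_apply, LinearMap.mulLeft_apply] at h
        exact h.trans_eq (by ring)
      rw [hcons, hRuv, regionTensor_sum, Finset.sum_mul]
      simp only [regionTensor_vecMulVec_productOp (I 0) _ _ _ S (extendFactor_coe _ _)]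
      calc p (∑ w, localAtom (I 0) (u w) (v w) S * Y)
          ≤ ∑ w, p (localAtom (I 0) (u w) (v w) S * Y) :=
            Finset.le_sum_of_subadditive p (map_zero p).le (map_add_le_add p) _ _
        _ ≤ ∑ w, M * k * c * (vecNorm (u w) * vecNorm (v w)) :=
            Finset.sum_le_sum fun w _ => hterm w
        _ = M * k * c * traceNorm (R 0) := by rw [← Finset.mul_sum, hsum]
        _ ≤ M * k * c * 1 := mul_le_mul_of_nonneg_left (hR 0) (mul_nonneg (mul_nonneg hM hk0) hc)
        _ = M * (k * c) := by ring

end OverlapProduct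

theorem mainTheorem5 {n ℓ : ℕ} (d : Fin n → ℕ)
    (q : (j : Fin n) → EuclideanSpace ℂ (Fin (d j))) (hq : ∀ j, ‖q j‖ = 1)
    (I : Fin ℓ → Finset (Fin n))
    (α : (i : Fin ℓ) → ↥(I i)ᶜ → ℝ) (hα : ∀ i j, 0 < α i j)
    (Q : (i : Fin ℓ) → (j : ↥(I i)ᶜ) → Matrix (Fin (d j)) (Fin (d j)) ℂ)
    (hQtop : ∀ i j, largestSingularValue (Q i j) = α i j)
    (hQform : ∀ i (j : ↥(I i)ᶜ), IsBlockForm (q j) (α i j) (Q i j))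
    (N : Seminorm ℂ (GlobalOp d)) (hN : IsUnitarilyInvariantNorm N) :
    (fun i => productOp (fun j : ↥(I i) => ketbra (q j))) ∈
        {R : (i : Fin ℓ) → RegionOp d (I i) | ∀ i, traceNorm (R i) ≤ 1} ∧
      IsMaxOn (fun R => N (overlapProduct I Q R))
        {R : (i : Fin ℓ) → RegionOp d (I i) | ∀ i, traceNorm (R i) ≤ 1}
        (fun i => productOp (fun j : ↥(I i) => ketbra (q j))) := by
  refine ⟨fun i => (traceNorm_productOp_ketbra (I i) q hq).le, fun R hR => ?_⟩
  -- a unit vector exists only in a nonzero space, so every index set is nonempty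
  have hne : ∀ j, Nonempty (Fin (d j)) := by
    intro j
    by_contra h
    have := not_nonempty_iff.1 h
    have hj := hq j
    rw [Subsingleton.elim (q j) 0, norm_zero] at hj
    exact zero_ne_one hj
  let z : ∀ j, Fin (d j) := fun j => (hne j).some
  obtain ⟨J, T, τ, c, hc, -, hopt, hbd⟩ := exists_overlapProduct_bound hq z I α Q
    fun i (j : ↥(I i)ᶜ) => (hQform i j).isLocalFactor (hq j) (hQtop i j)
  have hnorm := norm_localAtom hN J (J.restrict z) T
  set M := N (localAtom J (Pi.single (J.restrict z) 1) (Pi.single (J.restrict z) 1) T)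
  have hM : 0 ≤ M := apply_nonneg N _
  have h1 := hbd N M hM (fun u v => (hnorm u v).le.trans_eq (mul_comm _ _)) R hR
  have h2 : N (overlapProduct I Q fun i => productOp fun j : ↥(I i) => ketbra (q j)) = M * c := by
    rw [hopt, map_smul_eq_mul, hnorm, vecNorm_star, vecNorm_productVec J q hq, Complex.norm_real,
      Real.norm_of_nonneg hc]
    ring
  exact h1.trans_eq h2.symm
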